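/- For $t\in\mathbb C\setminus[9,\infty)$ let $$J(t)=\int_0^\infty\!\!\int_0^\infty\frac{dx\,dy}{A(x,y,t)},\qquad A(x,y,t)=(1+x+y)(x+y+xy)-xyt ,$$ be the (equal-mass, two-dimensional) sunset integral. For such $t$ the denominator has no zero with $x,y>0$, the integral converges absolutely, $J$ is analytic on $\mathbb C\setminus[9,\infty)$, and it satisfies there the inhomogeneous Picard–Fuchs equation $$\frac{d}{dt}\bigl(t(t-1)(t-9)\,J'(t)\bigr)+(t-3)\,J(t)=-6 .$$ Moreover, for $|t|<9$ one has the convergent expansion $J(t)=\sum_{n\ge0}I_n t^n$, where $$I_n=\int_0^\infty\!\!\int_0^\infty\frac{1}{\bigl((1+x+y)(1+x^{-1}+y^{-1})\bigr)^{n+1}}\,\frac{dx\,dy}{xy} =\frac{1}{4^{\,n-1}\,n!^2}\int_0^\infty x^{2n+1}K_0(x)^3\,dx\qquad(n\ge0),$$ all these integrals being absolutely convergent and $K_0(x)=\int_0^\infty e^{-x\cosh u}\,du$ being the modified Bessel function of the second kind. The coefficients obey $$n^2I_{n-1}-(3+10n+10n^2)I_n+9(n+1)^2I_{n+1}=0\qquad(n\ge1),$$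 and $I_1=(J(0)-2)/3$. -/

import Mathlib

namespace Sunset

open MeasureTheory

/-- The open first quadrant `(0, ∞) × (0, ∞)`, the domain of integration. -/
def quadrant : Set (ℝ × ℝ) := Set.Ioi 0 ×ˢ Set.Ioi 0

/-- The sunset polynomial `A(x, y, t) = (1 + x + y)(x + y + xy) - xyt`. -/
noncomputable def A (x y t : ℂ) : ℂ := (1 + x + y) * (x + y + x * y) - x * y * t

/-- The sunset integral `J(t) = ∫₀^∞ ∫₀^∞ dx dy / A(x, y, t)`, as a Lebesgue integral over
the quadrant. -/
noncomputable def J (t : ℂ) : ℂ := ∫ p in quadrant, 1 / A (p.1 : ℂ) (p.2 : ℂ) t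

/-- The cut plane `ℂ ∖ [9, ∞)`. -/
def cutPlane : Set ℂ := {t : ℂ | ∀ r : ℝ, 9 ≤ r → t ≠ (r : ℂ)}

/-- The integrand `((1 + x + y)(1 + 1/x + 1/y))^(-n-1) / (xy)`. -/
noncomputable def coeffIntegrand (n : ℕ) (p : ℝ × ℝ) : ℝ :=
  (((1 + p.1 + p.2) * (1 + p.1⁻¹ + p.2⁻¹)) ^ (n + 1))⁻¹ / (p.1 * p.2)

/-- The coefficient `I_n`, a Lebesgue integral over the quadrant. -/
noncomputable def I (n : ℕ) : ℝ := ∫ p in quadrant, coeffIntegrand n p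

/-- The modified Bessel function of the second kind of order zero,
`K₀(x) = ∫₀^∞ exp(-x cosh u) du` for `x > 0`. -/
noncomputable def K₀ (x : ℝ) : ℝ := ∫ u in Set.Ioi (0 : ℝ), Real.exp (-x * Real.cosh u)

end Sunset

/-! For `x, y > 0` one has `A = xy (D - t)` with `D = (1 + x + y)(1 + 1/x + 1/y) ≥ 9`. Off the cut,
`|D - t|` is therefore bounded below by a multiple of `D`, locally uniformly in `t`. This gives
absolute convergence and permits differentiation under the integral, and for `|t| < 9` the geometric
series in `t / D` gives `J(t) = ∑ I_n t^n`.

With `P = 1 + x + y` and `Q = 1 + 1/x + 1/y`, the quantity `n!² / (PQ)^(n+1)` is a product of two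
Gamma integrals. In the variables `u = z/(2w)`, `v = zw/2` its exponent splits into three pieces,
one each for `x`, `y` and `w`, and each of these integrals equals `2 K₀(z)`
(`lintegral_coeffIntegrand`). So `I_n` is a moment of `K₀³`.

`K₀³` satisfies a fourth-order equation, the symmetric cube of Bessel's. Integrating it against
powers of `x` relates three moments (`besselMoment_relation`). The boundary term vanishes for
exponents `m = 2n ≥ 2`, giving the recursion. For `m = 0` it is 6, since `x K₁(x) → 1` at 0, giving
`9 I_1 - 3 I_0 = -6`.

These relations say that the Picard–Fuchs operator applied to the power series leaves only the
constant `-6` on the unit disc. The identity theorem carries this to the cut plane, which is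
star-shaped about 0. -/

section
open MeasureTheory Set Filter Topology
namespace Sunset

/-! ### Derivatives, bounds and limits of `K₀` and `x K₁` -/

/-- The integral `∫₀^∞ cosh(u)^k exp(-x cosh u) du`. -/
noncomputable def coshMoment (k : ℕ) (x : ℝ) : ℝ :=
  ∫ u in Ioi (0 : ℝ), Real.cosh u ^ k * Real.exp (-x * Real.cosh u)

theorem one_add_sq_half_le_cosh {u : ℝ} (hu : 0 ≤ u) : 1 + u ^ 2 / 2 ≤ Real.cosh u := by
  have h1 : u / 2 ≤ Real.sinh (u / 2) := Real.self_le_sinh_iff.2 (by positivity)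
  have h2 : Real.cosh u = 1 + 2 * Real.sinh (u / 2) ^ 2 := by
    have := Real.cosh_two_mul (u / 2)
    rw [Real.cosh_sq, show 2 * (u / 2) = u by ring] at this
    linarith
  nlinarith

theorem exp_neg_mul_cosh_le {x u : ℝ} (hx : 0 ≤ x) (hu : 0 ≤ u) :
    Real.exp (-x * Real.cosh u) ≤ Real.exp (-x) * Real.exp (-(x / 2) * u ^ 2) := by
  rw [← Real.exp_add]
  apply Real.exp_le_exp.2
  nlinarith [one_add_sq_half_le_cosh hu]

/-- Half of the exponential decay absorbs the power, by `s^k / k! ≤ e^s` at `s = xy/2`. The majorant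
has the shape of the case `k = 0` at `x/2`, so that case controls all cosh moments. -/
theorem pow_mul_exp_neg_mul_le (k : ℕ) {x y : ℝ} (hx : 0 < x) (hy : 0 ≤ y) :
    y ^ k * Real.exp (-x * y) ≤ k.factorial * (2 / x) ^ k * Real.exp (-(x / 2) * y) := by
  have h := Real.pow_div_factorial_le_exp (x / 2 * y) (by positivity) k
  have h1 : Real.exp (-x * y) = Real.exp (-(x / 2) * y) * (Real.exp (x / 2 * y))⁻¹ := by
    rw [← Real.exp_neg, ← Real.exp_add]; ring_nf
  have h2 : y ^ k ≤ k.factorial * (2 / x) ^ k * Real.exp (x / 2 * y) := by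
    have h3 : y ^ k = k.factorial * (2 / x) ^ k * ((x / 2 * y) ^ k / k.factorial) := by
      have : (k.factorial : ℝ) ≠ 0 := by positivity
      rw [mul_pow, div_pow, div_pow]
      field_simp
    rw [h3]
    gcongr
  rw [h1, mul_comm (Real.exp (-(x / 2) * y)), ← mul_assoc]
  refine mul_le_mul_of_nonneg_right ?_ (Real.exp_pos _).le
  rw [← div_eq_mul_inv, div_le_iff₀ (Real.exp_pos _)]
  exact h2

theorem tendsto_exp_neg_mul_cosh {x : ℝ} (hx : 0 < x) :
    Tendsto (fun u => Real.exp (-x * Real.cosh u)) atTop (𝓝 0) := by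
  have hb : Tendsto (fun u : ℝ => Real.cosh u) atTop atTop := by
    refine tendsto_atTop_mono' _ ?_ (tendsto_id (α := ℝ))
    filter_upwards [eventually_ge_atTop 0] with u hu
    have := one_add_sq_half_le_cosh hu
    simp only [id]
    nlinarith [sq_nonneg (u - 1)]
  exact Real.tendsto_exp_atBot.comp (hb.const_mul_atTop_of_neg (by linarith))

theorem hasDerivAt_exp_neg_mul_cosh (x u : ℝ) :
    HasDerivAt (fun u => Real.exp (-x * Real.cosh u))
      (-(x * Real.sinh u * Real.exp (-x * Real.cosh u))) u :=
  ((Real.hasDerivAt_cosh u).const_mul (-x)).exp.congr_deriv (by ring)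

theorem integrableOn_exp_neg_mul_cosh {x : ℝ} (hx : 0 < x) :
    IntegrableOn (fun u : ℝ => Real.exp (-x * Real.cosh u)) (Ioi 0) := by
  refine Integrable.mono' (g := fun u => Real.exp (-x) * Real.exp (-(x / 2) * u ^ 2))
    ((integrable_exp_neg_mul_sq (half_pos hx)).integrableOn.const_mul _)
    (by fun_prop) ?_
  filter_upwards [ae_restrict_mem measurableSet_Ioi] with u hu
  rw [Real.norm_of_nonneg (by positivity)]
  exact exp_neg_mul_cosh_le hx.le (le_of_lt hu)

theorem integrableOn_cosh_pow_mul_exp (k : ℕ) {x : ℝ} (hx : 0 < x) :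
    IntegrableOn (fun u : ℝ => Real.cosh u ^ k * Real.exp (-x * Real.cosh u)) (Ioi 0) := by
  refine Integrable.mono'
    ((integrableOn_exp_neg_mul_cosh (half_pos hx)).const_mul (k.factorial * (2 / x) ^ k))
    (by fun_prop) ?_
  filter_upwards with u
  have := Real.cosh_pos u
  rw [Real.norm_of_nonneg (by positivity)]
  exact pow_mul_exp_neg_mul_le k hx this.le

theorem hasDerivAt_coshMoment (k : ℕ) {x : ℝ} (hx : 0 < x) :
    HasDerivAt (coshMoment k) (-coshMoment (k + 1) x) x := by
  have h := (hasDerivAt_integral_of_dominated_loc_of_deriv_le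
    (μ := volume.restrict (Ioi (0 : ℝ))) (𝕜 := ℝ) (x₀ := x) (s := Ioi (x / 2))
    (F := fun x u => Real.cosh u ^ k * Real.exp (-x * Real.cosh u))
    (F' := fun x u => -(Real.cosh u ^ (k + 1) * Real.exp (-x * Real.cosh u)))
    (bound := fun u => Real.cosh u ^ (k + 1) * Real.exp (-(x / 2) * Real.cosh u))
    (Ioi_mem_nhds (by linarith)) (Eventually.of_forall fun y => by fun_prop)
    (integrableOn_cosh_pow_mul_exp k hx) (by fun_prop) ?_
    (integrableOn_cosh_pow_mul_exp (k + 1) (half_pos hx)) ?_).2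
  · rw [integral_neg] at h
    exact h
  · refine Eventually.of_forall fun u y hy => ?_
    have := Real.cosh_pos u
    rw [norm_neg, Real.norm_of_nonneg (by positivity)]
    have : x / 2 < y := hy
    gcongr
  · refine Eventually.of_forall fun u y hy => ?_
    have h1 : HasDerivAt (fun y : ℝ => -y * Real.cosh u) (-Real.cosh u) y := by
      simpa using (hasDerivAt_id y).neg.mul_const (Real.cosh u)
    exact (h1.exp.const_mul (Real.cosh u ^ k)).congr_deriv (by ring)

/-- Integrate the derivative of `sinh u · exp(-x cosh u)`, whose boundary values vanish. This is
Bessel's equation, in the form that yields `(x K₁)' = -x K₀`. -/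
theorem coshMoment_two {x : ℝ} (hx : 0 < x) :
    coshMoment 1 x - x * coshMoment 2 x + x * coshMoment 0 x = 0 := by
  have hi := fun k => integrableOn_cosh_pow_mul_exp k hx
  have key := integral_Ioi_of_hasDerivAt_of_tendsto' (a := 0) (m := 0)
    (f := fun u => Real.sinh u * Real.exp (-x * Real.cosh u))
    (f' := fun u => Real.cosh u ^ 1 * Real.exp (-x * Real.cosh u)
      - x * (Real.cosh u ^ 2 * Real.exp (-x * Real.cosh u))
      + x * (Real.cosh u ^ 0 * Real.exp (-x * Real.cosh u))) ?_ ?_ ?_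
  · have e : ∫ u in Ioi (0 : ℝ), (Real.cosh u ^ 1 * Real.exp (-x * Real.cosh u)
      - x * (Real.cosh u ^ 2 * Real.exp (-x * Real.cosh u))
      + x * (Real.cosh u ^ 0 * Real.exp (-x * Real.cosh u)))
      = coshMoment 1 x - x * coshMoment 2 x + x * coshMoment 0 x := by
      refine (integral_add ((hi 1).sub ((hi 2).const_mul x)) ((hi 0).const_mul x)).trans ?_
      rw [integral_const_mul]
      congr 1
      refine (integral_sub (hi 1) ((hi 2).const_mul x)).trans ?_
      rw [integral_const_mul]
      rfl
    rw [e] at key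
    simpa using key
  · intro u _
    refine ((Real.hasDerivAt_sinh u).mul (hasDerivAt_exp_neg_mul_cosh x u)).congr_deriv ?_
    have := Real.sinh_sq u
    linear_combination (-x * Real.exp (-x * Real.cosh u)) * this
  · exact ((hi 1).sub ((hi 2).const_mul x)).add ((hi 0).const_mul x)
  · have h2 : Tendsto (fun u : ℝ => (2 / x) * Real.exp (-(x / 2) * Real.cosh u))
        atTop (𝓝 0) := by
      simpa using (tendsto_exp_neg_mul_cosh (half_pos hx)).const_mul (2 / x)
    refine squeeze_zero_norm (fun u => ?_) h2
    rw [norm_mul, Real.norm_of_nonneg (Real.exp_pos _).le]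
    refine le_trans ?_ ((pow_mul_exp_neg_mul_le 1 hx (Real.cosh_pos u).le).trans_eq (by simp))
    rw [pow_one]
    gcongr
    rw [Real.norm_eq_abs]
    apply abs_le_of_sq_le_sq _ (Real.cosh_pos u).le
    rw [Real.cosh_sq]; linarith

theorem K₀_eq_coshMoment (x : ℝ) : K₀ x = coshMoment 0 x := by
  simp [K₀, coshMoment]

/-- The function `x K₁(x)`. -/
noncomputable def xK₁ (x : ℝ) : ℝ := x * coshMoment 1 x

theorem hasDerivAt_K₀ {x : ℝ} (hx : 0 < x) : HasDerivAt K₀ (-(xK₁ x / x)) x := by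
  have : K₀ = coshMoment 0 := funext K₀_eq_coshMoment
  rw [this, xK₁, mul_div_cancel_left₀ _ hx.ne']
  exact hasDerivAt_coshMoment 0 hx

theorem hasDerivAt_xK₁ {x : ℝ} (hx : 0 < x) : HasDerivAt xK₁ (-(x * K₀ x)) x := by
  refine ((hasDerivAt_id x).mul (hasDerivAt_coshMoment 1 hx)).congr_deriv ?_
  rw [K₀_eq_coshMoment]
  simp only [id]
  linear_combination coshMoment_two hx

theorem K₀_nonneg (x : ℝ) : 0 ≤ K₀ x := integral_nonneg fun _ => (Real.exp_pos _).le

/-- Gaussian majorant from `cosh u ≥ 1 + u²/2`. The singularity `x^(-1/2)` at 0 is cruder than the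
true logarithm, but suffices for `x^k K₀³` with `k ≥ 1`. -/
theorem K₀_le {x : ℝ} (hx : 0 < x) : K₀ x ≤ Real.sqrt (Real.pi / 2) * (Real.exp (-x) / Real.sqrt x) := by
  have h := setIntegral_mono_on (integrableOn_exp_neg_mul_cosh hx)
    ((integrable_exp_neg_mul_sq (half_pos hx)).integrableOn.const_mul (Real.exp (-x)))
    measurableSet_Ioi (fun u hu => exp_neg_mul_cosh_le hx.le (le_of_lt hu))
  rw [integral_const_mul, integral_gaussian_Ioi] at h
  refine h.trans (le_of_eq ?_)
  rw [show Real.pi / (x / 2) = 2 ^ 2 * (Real.pi / 2 / x) by field_simp,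
    Real.sqrt_mul (by positivity), Real.sqrt_sq (by norm_num), Real.sqrt_div (by positivity)]
  field_simp

/-- Replacing `cosh` by `sinh` in `x K₁` makes the integrand an exact derivative with integral
`e^(-x)`. The error involves `cosh u - sinh u = e^(-u)`, which lies between 0 and 1. -/
theorem xK₁_bounds {x : ℝ} (hx : 0 < x) :
    Real.exp (-x) ≤ xK₁ x ∧ xK₁ x ≤ Real.exp (-x) + x * K₀ x := by
  have hsinh : IntegrableOn (fun u => x * Real.sinh u * Real.exp (-x * Real.cosh u)) (Ioi 0) := by
    refine Integrable.mono' ((integrableOn_cosh_pow_mul_exp 1 hx).const_mul x) (by fun_prop) ?_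
    filter_upwards [ae_restrict_mem measurableSet_Ioi] with u hu
    have h0 : 0 < Real.sinh u := Real.sinh_pos_iff.2 hu
    rw [Real.norm_of_nonneg (by positivity), pow_one, mul_assoc]
    gcongr
    exact (Real.sinh_lt_cosh u).le
  have hexp : ∫ u in Ioi (0 : ℝ), x * Real.sinh u * Real.exp (-x * Real.cosh u) = Real.exp (-x) := by
    rw [integral_Ioi_of_hasDerivAt_of_tendsto' (m := 0)
      (f := fun u => -Real.exp (-x * Real.cosh u)) ?_ hsinh ?_]
    · simp
    · intro u _
      exact (hasDerivAt_exp_neg_mul_cosh x u).neg.congr_deriv (by ring)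
    · simpa using (tendsto_exp_neg_mul_cosh hx).neg
  have hdiff : xK₁ x - Real.exp (-x) = ∫ u in Ioi (0 : ℝ),
      x * (Real.cosh u - Real.sinh u) * Real.exp (-x * Real.cosh u) := by
    rw [← hexp, xK₁, coshMoment, ← integral_const_mul,
      ← integral_sub ((integrableOn_cosh_pow_mul_exp 1 hx).const_mul x) hsinh]
    congr 1; ext u; ring
  constructor
  · rw [← sub_nonneg, hdiff]
    refine integral_nonneg fun u => ?_
    have := (Real.sinh_lt_cosh u).le
    have h2 : 0 ≤ Real.cosh u - Real.sinh u := by linarith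
    simp only [Pi.zero_apply]
    positivity
  · rw [← sub_le_iff_le_add', hdiff, K₀, ← integral_const_mul]
    refine setIntegral_mono_on ?_ ((integrableOn_exp_neg_mul_cosh hx).const_mul x)
      measurableSet_Ioi fun u hu => ?_
    · refine Integrable.congr (((integrableOn_cosh_pow_mul_exp 1 hx).const_mul x).sub hsinh) ?_
      refine Eventually.of_forall fun u => ?_
      simp only [Pi.sub_apply]
      ring
    · gcongr
      rw [Real.cosh_sub_sinh]
      have : Real.exp (-u) ≤ 1 := Real.exp_le_one_iff.2 (by linarith [mem_Ioi.1 hu])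
      nlinarith

theorem continuousOn_K₀ : ContinuousOn K₀ (Ioi 0) := fun _ hx =>
  (hasDerivAt_K₀ hx).continuousAt.continuousWithinAt

theorem integrableOn_pow_mul_K₀_cube {k : ℕ} (hk : 1 ≤ k) :
    IntegrableOn (fun x : ℝ => x ^ k * K₀ x ^ 3) (Ioi 0) := by
  have hk' : (1 : ℝ) ≤ k := by exact_mod_cast hk
  refine Integrable.mono'
    ((Real.GammaIntegral_convergent (s := k - 1 / 2) (by linarith)).const_mul
      (Real.sqrt (Real.pi / 2) ^ 3))
    (((continuousOn_id.pow k).mul (continuousOn_K₀.pow 3)).aestronglyMeasurable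
      measurableSet_Ioi) ?_
  filter_upwards [ae_restrict_mem measurableSet_Ioi] with x hx
  have hx : 0 < x := hx
  have h0 := K₀_nonneg x
  rw [Real.norm_of_nonneg (by positivity)]
  have h1 : x ^ ((k : ℝ) - 1 / 2 - 1) = x ^ k / Real.sqrt x ^ 3 := by
    rw [Real.sqrt_eq_rpow, ← Real.rpow_natCast, ← Real.rpow_natCast, ← Real.rpow_mul hx.le,
      ← Real.rpow_sub hx]
    norm_num
    ring_nf
  rw [h1]
  calc x ^ k * K₀ x ^ 3
      ≤ x ^ k * (Real.sqrt (Real.pi / 2) * (Real.exp (-x) / Real.sqrt x)) ^ 3 := by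
        gcongr; exact K₀_le hx
    _ = Real.sqrt (Real.pi / 2) ^ 3 * (Real.exp (-x) ^ 3 * (x ^ k / Real.sqrt x ^ 3)) := by
        rw [mul_pow, div_pow]; ring
    _ ≤ _ := by
        gcongr
        exact pow_le_of_le_one (Real.exp_pos _).le (Real.exp_le_one_iff.2 (by linarith)) (by norm_num)

theorem tendsto_mul_K₀_zero :
    Tendsto (fun x => x * K₀ x) (𝓝[>] 0) (𝓝 0) ∧
    Tendsto (fun x => x ^ 2 * K₀ x ^ 3) (𝓝[>] 0) (𝓝 0) := by
  have hs : Tendsto (fun x : ℝ => Real.sqrt x) (𝓝[>] 0) (𝓝 0) := by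
    have := (Real.continuous_sqrt.tendsto 0).mono_left (nhdsWithin_le_nhds (s := Ioi 0))
    simpa using this
  have hb : ∀ x : ℝ, 0 < x → Real.sqrt x * K₀ x ≤ Real.sqrt (Real.pi / 2) := by
    intro x hx
    have := K₀_le hx
    have hsx := Real.sqrt_pos.2 hx
    calc Real.sqrt x * K₀ x
        ≤ Real.sqrt x * (Real.sqrt (Real.pi / 2) * (Real.exp (-x) / Real.sqrt x)) := by gcongr
      _ = Real.sqrt (Real.pi / 2) * Real.exp (-x) := by field_simp
      _ ≤ Real.sqrt (Real.pi / 2) * 1 := by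
        gcongr; exact Real.exp_le_one_iff.2 (by linarith)
      _ = _ := mul_one _
  constructor
  · refine squeeze_zero' (g := fun x => Real.sqrt x * Real.sqrt (Real.pi / 2)) ?_ ?_
      (by simpa using hs.mul_const (Real.sqrt (Real.pi / 2)))
    · filter_upwards [self_mem_nhdsWithin] with x hx
      exact mul_nonneg (le_of_lt hx) (K₀_nonneg x)
    · filter_upwards [self_mem_nhdsWithin] with x hx
      have h := Real.mul_self_sqrt (le_of_lt (mem_Ioi.1 hx))
      nth_rewrite 1 [← h]
      rw [mul_assoc]
      exact mul_le_mul_of_nonneg_left (hb x hx) (Real.sqrt_nonneg _)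
  · refine squeeze_zero' (g := fun x => Real.sqrt x * Real.sqrt (Real.pi / 2) ^ 3) ?_ ?_
      (by simpa using hs.mul_const (Real.sqrt (Real.pi / 2) ^ 3))
    · filter_upwards [self_mem_nhdsWithin] with x hx
      exact mul_nonneg (sq_nonneg x) (pow_nonneg (K₀_nonneg x) 3)
    · filter_upwards [self_mem_nhdsWithin] with x hx
      have h := Real.sq_sqrt (le_of_lt (mem_Ioi.1 hx))
      nth_rewrite 1 [← h]
      have := K₀_nonneg x
      calc _ = Real.sqrt x * (Real.sqrt x * K₀ x) ^ 3 := by ring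
        _ ≤ _ := by gcongr; exact hb x hx

theorem tendsto_xK₁_zero : Tendsto xK₁ (𝓝[>] 0) (𝓝 1) := by
  have he : Tendsto (fun x : ℝ => Real.exp (-x)) (𝓝[>] 0) (𝓝 1) := by
    have : Tendsto (fun x : ℝ => Real.exp (-x)) (𝓝 0) (𝓝 (Real.exp (-0))) :=
      (Real.continuous_exp.comp continuous_neg).tendsto 0
    simpa using this.mono_left (nhdsWithin_le_nhds (s := Ioi 0))
  refine tendsto_of_tendsto_of_tendsto_of_le_of_le' he
    (by simpa using he.add tendsto_mul_K₀_zero.1) ?_ ?_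
  · filter_upwards [self_mem_nhdsWithin] with x hx using (xK₁_bounds hx).1
  · filter_upwards [self_mem_nhdsWithin] with x hx using (xK₁_bounds hx).2

theorem tendsto_pow_mul_K₀_atTop (k : ℕ) : Tendsto (fun x => x ^ k * K₀ x) atTop (𝓝 0) := by
  have hlim := (Real.tendsto_pow_mul_exp_neg_atTop_nhds_zero k).const_mul (Real.sqrt (Real.pi / 2))
  rw [mul_zero] at hlim
  refine squeeze_zero' ?_ ?_ hlim
  · filter_upwards [eventually_ge_atTop 0] with x hx
    exact mul_nonneg (pow_nonneg hx k) (K₀_nonneg x)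
  · filter_upwards [eventually_ge_atTop 1] with x hx
    have h0 : 0 < x := by linarith
    calc x ^ k * K₀ x ≤ x ^ k * (Real.sqrt (Real.pi / 2) * (Real.exp (-x) / Real.sqrt x)) := by
          gcongr; exact K₀_le h0
      _ ≤ x ^ k * (Real.sqrt (Real.pi / 2) * (Real.exp (-x) / 1)) := by
          gcongr; exact Real.one_le_sqrt.2 hx
      _ = _ := by ring

theorem tendsto_pow_mul_xK₁_atTop (k : ℕ) : Tendsto (fun x => x ^ k * xK₁ x) atTop (𝓝 0) := by
  have hlim := (Real.tendsto_pow_mul_exp_neg_atTop_nhds_zero k).add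
    (tendsto_pow_mul_K₀_atTop (k + 1))
  rw [add_zero] at hlim
  refine squeeze_zero' ?_ ?_ hlim
  · filter_upwards [eventually_gt_atTop 0] with x hx
    exact mul_nonneg (pow_nonneg hx.le k) ((Real.exp_pos _).le.trans (xK₁_bounds hx).1)
  · filter_upwards [eventually_gt_atTop 0] with x hx
    calc x ^ k * xK₁ x ≤ x ^ k * (Real.exp (-x) + x * K₀ x) := by
          gcongr; exact (xK₁_bounds hx).2
      _ = _ := by ring

/-! ### Symmetric cube of the Bessel equation and the moment relation -/

/-- A primitive of the combination of `x^(m-1) K₀³`, `x^(m+1) K₀³` and `x^(m+3) K₀³` whose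
coefficients come from the symmetric cube of the Bessel equation. -/
noncomputable def besselPrimitive (m : ℕ) (x : ℝ) : ℝ :=
  x ^ m * ((m ^ 3 - (7 * m + 6) * x ^ 2) * K₀ x ^ 3 + (3 * m ^ 2 - 9 * x ^ 2) * K₀ x ^ 2 * xK₁ x
    + 6 * m * K₀ x * xK₁ x ^ 2 + 6 * xK₁ x ^ 3)

/-- With `θ = x d/dx`, `F = K₀³` is annihilated by `θ⁴ - 10x²θ² - 20x²θ - 12x² + 9x⁴`. Multiplying
by `x^(m-1)` and integrating by parts moves `θ` onto the power; up to sign, the primitive collects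
the boundary terms. -/
theorem hasDerivAt_besselPrimitive (m : ℕ) {x : ℝ} (hx : 0 < x) :
    HasDerivAt (besselPrimitive m) (m ^ 4 * (x ^ (m - 1) * K₀ x ^ 3)
      - (10 * m ^ 2 + 20 * m + 12) * (x ^ (m + 1) * K₀ x ^ 3) + 9 * (x ^ (m + 3) * K₀ x ^ 3)) x := by
  have hK := hasDerivAt_K₀ hx
  have hG := hasDerivAt_xK₁ hx
  have h2 := (hasDerivAt_id x).fun_pow 2
  have hd := ((hasDerivAt_id x).fun_pow m).fun_mul (((((h2.const_mul (7 * (m : ℝ) + 6)).const_sub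
    ((m : ℝ) ^ 3)).fun_mul (hK.fun_pow 3)).fun_add ((((h2.const_mul 9).const_sub
    (3 * (m : ℝ) ^ 2)).fun_mul (hK.fun_pow 2)).fun_mul hG)).fun_add
    ((hK.const_mul (6 * (m : ℝ))).fun_mul (hG.fun_pow 2)) |>.fun_add ((hG.fun_pow 3).const_mul 6))
  refine hd.congr_deriv ?_
  rcases m with _ | j
  · simp only [id]
    field_simp
    push_cast
    ring
  · simp only [id, Nat.add_sub_cancel]
    field_simp
    push_cast
    ring

theorem tendsto_besselPrimitive_atTop (m : ℕ) : Tendsto (besselPrimitive m) atTop (𝓝 0) := by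
  have hK := tendsto_pow_mul_K₀_atTop
  have hG := tendsto_pow_mul_xK₁_atTop
  have k0 : Tendsto K₀ atTop (𝓝 0) := by simpa using hK 0
  have g0 : Tendsto xK₁ atTop (𝓝 0) := by simpa using hG 0
  have h := (((((hK m).const_mul ((m : ℝ) ^ 3)).sub ((hK (m + 2)).const_mul (7 * (m : ℝ) + 6))).mul
    (k0.pow 2)).add ((((hK m).const_mul (3 * (m : ℝ) ^ 2)).sub ((hK (m + 2)).const_mul 9)).mul
    (k0.mul g0))).add (((hK m).const_mul (6 * (m : ℝ))).mul (g0.pow 2)) |>.add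
    (((hG m).const_mul 6).mul (g0.pow 2))
  norm_num at h
  refine h.congr fun x => ?_
  rw [besselPrimitive]
  ring

theorem tendsto_besselPrimitive_zero : Tendsto (besselPrimitive 0) (𝓝[>] 0) (𝓝 6) := by
  obtain ⟨h1, h3⟩ := tendsto_mul_K₀_zero
  have hG := tendsto_xK₁_zero
  have h := ((h3.const_mul (-6)).add (((h1.pow 2).const_mul (-9)).mul hG)).add
    ((hG.pow 3).const_mul 6)
  norm_num at h
  refine h.congr fun x => ?_
  simp only [besselPrimitive]
  push_cast
  ring

theorem tendsto_besselPrimitive_add_two_zero (j : ℕ) :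
    Tendsto (besselPrimitive (j + 2)) (𝓝[>] 0) (𝓝 0) := by
  obtain ⟨h1, h3⟩ := tendsto_mul_K₀_zero
  have hG := tendsto_xK₁_zero
  have hx : Tendsto (fun x : ℝ => x) (𝓝[>] 0) (𝓝 0) := tendsto_id.mono_left nhdsWithin_le_nhds
  have hx2 : Tendsto (fun x : ℝ => x ^ 2) (𝓝[>] 0) (𝓝 0) := by simpa using hx.pow 2
  have h12 : Tendsto (fun x : ℝ => (x * K₀ x) ^ 2) (𝓝[>] 0) (𝓝 0) := by simpa using h1.pow 2
  have h := ((((hx2.const_mul (7 * ((j : ℝ) + 2) + 6)).const_sub (((j : ℝ) + 2) ^ 3)).mul h3).add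
    (((hx2.const_mul 9).const_sub (3 * ((j : ℝ) + 2) ^ 2)).mul (h12.mul hG))).add
    ((hx.mul (h1.mul (hG.pow 2))).const_mul (6 * ((j : ℝ) + 2))) |>.add
    ((hx2.mul (hG.pow 3)).const_mul 6)
  have h' := (hx.pow j).mul h
  simp only [mul_zero, zero_mul, add_zero] at h'
  refine h'.congr fun x => ?_
  simp only [besselPrimitive]
  push_cast
  ring

theorem besselMoment_relation {m : ℕ} {l : ℝ} (hm : m ≠ 1)
    (hl : Tendsto (besselPrimitive m) (𝓝[>] 0) (𝓝 l)) :
    m ^ 4 * (∫ x in Ioi (0 : ℝ), x ^ (m - 1) * K₀ x ^ 3)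
      - (10 * m ^ 2 + 20 * m + 12) * (∫ x in Ioi (0 : ℝ), x ^ (m + 1) * K₀ x ^ 3)
      + 9 * (∫ x in Ioi (0 : ℝ), x ^ (m + 3) * K₀ x ^ 3) = -l := by
  -- For `m = 0` the truncated exponent `m - 1` is harmless because its coefficient `m⁴` vanishes.
  -- The case `m = 1` would need `∫ K₀³`, which the bound on `x^k K₀³` for `k ≥ 1` does not cover.
  have i1 : IntegrableOn (fun x : ℝ => (m : ℝ) ^ 4 * (x ^ (m - 1) * K₀ x ^ 3)) (Ioi 0) := by
    rcases Nat.eq_zero_or_pos m with rfl | hm'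
    · simp
    · exact (integrableOn_pow_mul_K₀_cube (by omega)).const_mul _
  have i2 := (integrableOn_pow_mul_K₀_cube (k := m + 1) (by omega)).const_mul
    (10 * (m : ℝ) ^ 2 + 20 * m + 12)
  have i3 := (integrableOn_pow_mul_K₀_cube (k := m + 3) (by omega)).const_mul 9
  have hint := (i1.sub i2).add i3
  -- Integration by parts against the constant 1 is the fundamental theorem with a one-sided limit
  -- at 0 in place of an endpoint value.
  have key := integral_Ioi_deriv_mul_eq_sub (a := 0) (a' := l) (b' := 0) (u := fun _ => 1)
    (u' := fun _ => 0)
    (fun x _ => hasDerivAt_const x (1 : ℝ)) (fun x hx => hasDerivAt_besselPrimitive m hx)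
    (Integrable.congr hint (Eventually.of_forall fun x => by simp))
    (hl.congr fun x => by simp) ((tendsto_besselPrimitive_atTop m).congr fun x => by simp)
  simp only [zero_mul, one_mul, zero_add, zero_sub] at key
  rw [← key, ← integral_const_mul, ← integral_const_mul, ← integral_const_mul]
  symm
  refine (integral_add (i1.sub i2) i3).trans ?_
  congr 1
  exact integral_sub i1 i2

/-! ### The coefficients as Bessel moments, by Tonelli in `ENNReal` -/

theorem lintegral_Ioi_comp_mul {c : ℝ} (hc : 0 < c) (g : ℝ → ENNReal) :
    ∫⁻ x in Ioi (0 : ℝ), g x = ∫⁻ x in Ioi (0 : ℝ), ENNReal.ofReal c * g (c * x) := by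
  have h := lintegral_image_eq_lintegral_abs_deriv_mul (s := Ioi (0 : ℝ)) (f := fun x => c * x)
    (f' := fun _ => c) measurableSet_Ioi
    (fun x _ => by simpa using ((hasDerivAt_id x).const_mul c).hasDerivWithinAt)
    (fun x _ y _ hxy => mul_left_cancel₀ hc.ne' hxy) g
  rw [abs_of_pos hc] at h
  rw [← h]
  congr 2
  ext x
  constructor
  · intro hx
    exact ⟨x / c, div_pos hx hc, by field_simp⟩
  · rintro ⟨y, hy, rfl⟩
    exact mul_pos hc hy

theorem lintegral_Ioi_comp_sq {v : ℝ} (hv : 0 < v) (g : ℝ → ENNReal) :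
    ∫⁻ x in Ioi (0 : ℝ), g x
      = ∫⁻ z in Ioi (0 : ℝ), ENNReal.ofReal (z / (2 * v)) * g (z ^ 2 / (4 * v)) := by
  have h := lintegral_image_eq_lintegral_abs_deriv_mul (s := Ioi (0 : ℝ))
    (f := fun z => z ^ 2 / (4 * v)) (f' := fun z => z / (2 * v)) measurableSet_Ioi
    (fun x _ => (((hasDerivAt_id x).fun_pow 2).div_const (4 * v)).congr_deriv
      (by simp only [id]; field_simp; ring) |>.hasDerivWithinAt)
    (fun x hx y hy hxy => by
      have hxy : x ^ 2 / (4 * v) = y ^ 2 / (4 * v) := hxy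
      rw [div_left_inj' (by positivity)] at hxy
      exact (sq_eq_sq₀ (le_of_lt hx) (le_of_lt hy)).1 hxy) g
  have himg : (fun z : ℝ => z ^ 2 / (4 * v)) '' Ioi 0 = Ioi 0 := by
    ext x
    constructor
    · rintro ⟨y, hy, rfl⟩
      have : 0 < y := hy
      show 0 < y ^ 2 / (4 * v)
      positivity
    · intro hx
      have hx : 0 < x := hx
      refine ⟨Real.sqrt (4 * v * x), Real.sqrt_pos.2 (by positivity), ?_⟩
      simp only
      rw [Real.sq_sqrt (by positivity)]
      field_simp
  rw [himg] at h
  rw [h]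
  refine setLIntegral_congr_fun measurableSet_Ioi fun z hz => ?_
  have : 0 < z := hz
  rw [abs_of_pos (by positivity)]

theorem integrable_exp_neg_mul_cosh {z : ℝ} (hz : 0 < z) :
    Integrable (fun u : ℝ => Real.exp (-z * Real.cosh u)) := by
  refine Integrable.mono' (g := fun u => Real.exp (-z) * Real.exp (-(z / 2) * u ^ 2))
    ((integrable_exp_neg_mul_sq (half_pos hz)).const_mul _) (by fun_prop) ?_
  filter_upwards with u
  rw [Real.norm_of_nonneg (by positivity)]
  have := exp_neg_mul_cosh_le hz.le (abs_nonneg u)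
  rwa [Real.cosh_abs, sq_abs] at this

/-- Substitute `s = e^u`; evenness of `cosh` accounts for the factor 2. -/
theorem lintegral_exp_eq_K₀ {z : ℝ} (hz : 0 < z) :
    ∫⁻ s in Ioi (0 : ℝ), ENNReal.ofReal (Real.exp (-(z / 2) * (s + s⁻¹)) / s)
      = ENNReal.ofReal (2 * K₀ z) := by
  have h := lintegral_image_eq_lintegral_abs_deriv_mul (s := univ) (f := Real.exp)
    (f' := Real.exp) MeasurableSet.univ (fun x _ => (Real.hasDerivAt_exp x).hasDerivWithinAt)
    Real.exp_injective.injOn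
    (fun s => ENNReal.ofReal (Real.exp (-(z / 2) * (s + s⁻¹)) / s))
  rw [image_univ, Real.range_exp, setLIntegral_univ] at h
  rw [h]
  have h2 : ∀ u : ℝ, ENNReal.ofReal |Real.exp u| * ENNReal.ofReal
      (Real.exp (-(z / 2) * (Real.exp u + (Real.exp u)⁻¹)) / Real.exp u)
      = ENNReal.ofReal (Real.exp (-z * Real.cosh u)) := by
    intro u
    rw [← ENNReal.ofReal_mul (abs_nonneg _), abs_of_pos (Real.exp_pos u),
      mul_div_cancel₀ _ (Real.exp_pos u).ne', ← Real.exp_neg, Real.cosh_eq]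
    congr 2
    ring
  simp_rw [h2]
  rw [← ofReal_integral_eq_lintegral_ofReal (integrable_exp_neg_mul_cosh hz)
    (Eventually.of_forall fun u => (Real.exp_pos _).le)]
  congr 1
  have := integral_comp_abs (f := fun u => Real.exp (-z * Real.cosh u))
  simpa [K₀] using this

theorem lintegral_pow_mul_exp (n : ℕ) {P : ℝ} (hP : 0 < P) :
    ∫⁻ u in Ioi (0 : ℝ), ENNReal.ofReal (u ^ n * Real.exp (-(P * u)))
      = ENNReal.ofReal (n.factorial / P ^ (n + 1)) := by
  have h := Real.integral_rpow_mul_exp_neg_mul_Ioi (a := n + 1) (by positivity) hP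
  have h1 : ∫ t in Ioi (0 : ℝ), t ^ ((n : ℝ) + 1 - 1) * Real.exp (-(P * t))
      = ∫ t in Ioi (0 : ℝ), t ^ n * Real.exp (-(P * t)) := by
    simp [Real.rpow_natCast]
  have h2 : (1 / P) ^ ((n : ℝ) + 1) * Real.Gamma (n + 1) = n.factorial / P ^ (n + 1) := by
    rw [Real.Gamma_nat_eq_factorial]
    have : ((n : ℝ) + 1) = ((n + 1 : ℕ) : ℝ) := by push_cast; ring
    rw [this, Real.rpow_natCast, one_div, inv_pow]
    field_simp
  rw [h1, h2] at h
  rw [← h, ofReal_integral_eq_lintegral_ofReal]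
  · exact .of_integral_ne_zero (by rw [h]; positivity)
  · filter_upwards [ae_restrict_mem measurableSet_Ioi] with t ht
    have : 0 < t := ht
    simp only [Pi.zero_apply]
    positivity

/-- A product of two Gamma integrals, in the coordinates `u = z / (2 w)`, `v = z w / 2`. -/
theorem lintegral_double_exp (n : ℕ) {P Q : ℝ} (hP : 0 < P) (hQ : 0 < Q) :
    ∫⁻ q in quadrant, ENNReal.ofReal (q.1 ^ (2 * n + 1) / (2 * 4 ^ n)
        * (Real.exp (-(q.1 / 2) * (P / q.2 + Q * q.2)) / q.2))
      = ENNReal.ofReal ((n.factorial : ℝ) ^ 2 / (P * Q) ^ (n + 1)) := by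
  rw [quadrant, Measure.volume_eq_prod, ← Measure.prod_restrict,
    lintegral_prod _ (by fun_prop)]
  have e1 : (n.factorial : ℝ) ^ 2 / (P * Q) ^ (n + 1)
      = n.factorial / Q ^ (n + 1) * (n.factorial / P ^ (n + 1)) := by
    rw [mul_pow]; field_simp
  rw [e1, ENNReal.ofReal_mul (by positivity), ← lintegral_pow_mul_exp n hP,
    ← lintegral_pow_mul_exp n hQ, ← lintegral_mul_const _ (by fun_prop)]
  -- At fixed `v`, substitute `u = z²/(4v)`; after exchanging the integrals, `v = (z/2) w` at fixed
  -- `z` completes the change of coordinates.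
  have e2 : ∀ v ∈ Ioi (0 : ℝ), ENNReal.ofReal (v ^ n * Real.exp (-(Q * v)))
      * (∫⁻ u in Ioi (0 : ℝ), ENNReal.ofReal (u ^ n * Real.exp (-(P * u))))
      = ∫⁻ z in Ioi (0 : ℝ), ENNReal.ofReal (z ^ (2 * n + 1) / (2 * 4 ^ n)
        * (Real.exp (-(Q * v + P * (z ^ 2 / (4 * v)))) / v)) := by
    intro v hv
    have hv : 0 < v := hv
    rw [lintegral_Ioi_comp_sq hv, ← lintegral_const_mul _ (by fun_prop)]
    refine setLIntegral_congr_fun measurableSet_Ioi fun z hz => ?_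
    have hz : 0 < z := hz
    rw [← ENNReal.ofReal_mul (by positivity), ← ENNReal.ofReal_mul (by positivity)]
    congr 1
    rw [neg_add, Real.exp_add, div_pow, mul_pow]
    field_simp
    ring
  rw [setLIntegral_congr_fun measurableSet_Ioi e2]
  conv_rhs => rw [lintegral_lintegral_swap (by fun_prop)]
  refine setLIntegral_congr_fun measurableSet_Ioi fun z hz => ?_
  have hz : 0 < z := hz
  simp only
  conv_rhs => rw [lintegral_Ioi_comp_mul (half_pos hz)]
  refine setLIntegral_congr_fun measurableSet_Ioi fun w hw => ?_
  have hw : 0 < w := hw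
  rw [← ENNReal.ofReal_mul (by positivity)]
  congr 1
  have : -(Q * (z / 2 * w) + P * (z ^ 2 / (4 * (z / 2 * w)))) = -(z / 2) * (P / w + Q * w) := by
    field_simp
    ring
  rw [this]
  field_simp

theorem lintegral_scaled_exp_eq_K₀ {z w : ℝ} (hz : 0 < z) (hw : 0 < w) :
    ∫⁻ x in Ioi (0 : ℝ), ENNReal.ofReal (Real.exp (-(z / 2) * (x / w + w * x⁻¹)) / x)
      = ENNReal.ofReal (2 * K₀ z) := by
  rw [lintegral_Ioi_comp_mul hw, ← lintegral_exp_eq_K₀ hz]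
  refine setLIntegral_congr_fun measurableSet_Ioi fun x hx => ?_
  have hx : 0 < x := hx
  rw [← ENNReal.ofReal_mul (by positivity)]
  congr 1
  have : w * x / w + w * (w * x)⁻¹ = x + x⁻¹ := by field_simp
  rw [this]
  field_simp

theorem measurableSet_quadrant : MeasurableSet quadrant := measurableSet_Ioi.prod measurableSet_Ioi

theorem measurable_coeffIntegrand (n : ℕ) : Measurable (coeffIntegrand n) := by
  unfold coeffIntegrand; fun_prop

/-- The exponent is `-(z/2)` times `(x/w + w/x) + (y/w + w/y) + (w + 1/w)`, so each of the `x`, `y`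
and `w` integrals gives `2 K₀(z)`. The constant is `8 / (2 · 4^n)`. No integrability is assumed, so
that of the left side can be deduced from the right. -/
theorem lintegral_coeffIntegrand (n : ℕ) :
    ENNReal.ofReal ((n.factorial : ℝ) ^ 2) * ∫⁻ p in quadrant, ENNReal.ofReal (coeffIntegrand n p)
      = ENNReal.ofReal (4 / 4 ^ n)
        * ∫⁻ z in Ioi (0 : ℝ), ENNReal.ofReal (z ^ (2 * n + 1) * K₀ z ^ 3) := by
  have hq := measurableSet_quadrant
  have hm := measurable_coeffIntegrand n
  rw [← lintegral_const_mul _ (by fun_prop)]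
  have e1 : ∀ p ∈ quadrant, ENNReal.ofReal ((n.factorial : ℝ) ^ 2)
      * ENNReal.ofReal (coeffIntegrand n p)
      = ∫⁻ q in quadrant, ENNReal.ofReal (1 / (p.1 * p.2))
        * ENNReal.ofReal (q.1 ^ (2 * n + 1) / (2 * 4 ^ n)
        * (Real.exp (-(q.1 / 2) * ((1 + p.1 + p.2) / q.2 + (1 + p.1⁻¹ + p.2⁻¹) * q.2)) / q.2)) := by
    rintro ⟨x, y⟩ ⟨hx, hy⟩
    have hx : 0 < x := hx
    have hy : 0 < y := hy
    rw [lintegral_const_mul _ (by fun_prop), lintegral_double_exp n (by positivity) (by positivity),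
      ← ENNReal.ofReal_mul (by positivity), ← ENNReal.ofReal_mul (by positivity), coeffIntegrand]
    congr 1
    ring
  rw [setLIntegral_congr_fun hq e1, lintegral_lintegral_swap (by fun_prop)]
  have e2 : ∀ q ∈ quadrant, (∫⁻ p in quadrant, ENNReal.ofReal (1 / (p.1 * p.2))
        * ENNReal.ofReal (q.1 ^ (2 * n + 1) / (2 * 4 ^ n)
        * (Real.exp (-(q.1 / 2) * ((1 + p.1 + p.2) / q.2 + (1 + p.1⁻¹ + p.2⁻¹) * q.2)) / q.2)))
      = ENNReal.ofReal (q.1 ^ (2 * n + 1) / (2 * 4 ^ n) * (2 * K₀ q.1) * (2 * K₀ q.1))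
        * ENNReal.ofReal (Real.exp (-(q.1 / 2) * (q.2 + q.2⁻¹)) / q.2) := by
    rintro ⟨z, w⟩ ⟨hz, hw⟩
    have hz : 0 < z := hz
    have hw : 0 < w := hw
    have hK := K₀_nonneg z
    simp only
    rw [ENNReal.ofReal_mul (by positivity), ENNReal.ofReal_mul (by positivity)]
    have hscale := lintegral_scaled_exp_eq_K₀ hz hw
    rw [← hscale, mul_assoc (ENNReal.ofReal _), ← lintegral_prod_mul (by fun_prop) (by fun_prop),
      Measure.prod_restrict, ← Measure.volume_eq_prod, ← lintegral_const_mul _ (by fun_prop),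
      ← lintegral_mul_const _ (by fun_prop)]
    refine setLIntegral_congr_fun hq ?_
    rintro ⟨x, y⟩ ⟨hx, hy⟩
    have hx : 0 < x := hx
    have hy : 0 < y := hy
    simp only
    rw [← ENNReal.ofReal_mul (by positivity), ← ENNReal.ofReal_mul (by positivity),
      ← ENNReal.ofReal_mul (by positivity), ← ENNReal.ofReal_mul (by positivity)]
    congr 1
    have : -(z / 2) * ((1 + x + y) / w + (1 + x⁻¹ + y⁻¹) * w) = -(z / 2) * (x / w + w * x⁻¹)
        + -(z / 2) * (y / w + w * y⁻¹) + -(z / 2) * (w + w⁻¹) := by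
      field_simp
      ring
    rw [this, Real.exp_add, Real.exp_add]
    field_simp
  have hKm : AEMeasurable K₀ (volume.restrict (Ioi 0)) :=
    continuousOn_K₀.aemeasurable measurableSet_Ioi
  have hKm1 : AEMeasurable (fun q : ℝ × ℝ => K₀ q.1)
      ((volume.restrict (Ioi 0)).prod (volume.restrict (Ioi 0))) :=
    hKm.comp_fst
  rw [setLIntegral_congr_fun hq e2, quadrant, Measure.volume_eq_prod, ← Measure.prod_restrict,
    lintegral_prod _ (by fun_prop), ← lintegral_const_mul'' _ (by fun_prop)]
  refine setLIntegral_congr_fun measurableSet_Ioi fun z hz => ?_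
  have hz : 0 < z := hz
  have hK := K₀_nonneg z
  simp only
  rw [lintegral_const_mul _ (by fun_prop), lintegral_exp_eq_K₀ hz,
    ← ENNReal.ofReal_mul (by positivity), ← ENNReal.ofReal_mul (by positivity)]
  congr 1
  field_simp
  ring

theorem coeffIntegrand_nonneg (n : ℕ) {p : ℝ × ℝ} (hp : p ∈ quadrant) : 0 ≤ coeffIntegrand n p := by
  obtain ⟨hx, hy⟩ := hp
  have hx : 0 < p.1 := hx
  have hy : 0 < p.2 := hy
  unfold coeffIntegrand
  positivity

theorem lintegral_coeffIntegrand_eq (n : ℕ) :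
    ENNReal.ofReal ((n.factorial : ℝ) ^ 2) * ∫⁻ p in quadrant, ENNReal.ofReal (coeffIntegrand n p)
      = ENNReal.ofReal (4 / 4 ^ n * ∫ z in Ioi (0 : ℝ), z ^ (2 * n + 1) * K₀ z ^ 3) := by
  rw [lintegral_coeffIntegrand, ENNReal.ofReal_mul (by positivity),
    ofReal_integral_eq_lintegral_ofReal (integrableOn_pow_mul_K₀_cube (by omega))]
  filter_upwards [ae_restrict_mem measurableSet_Ioi] with z hz
  exact mul_nonneg (pow_nonneg (le_of_lt hz) _) (pow_nonneg (K₀_nonneg z) 3)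

theorem integrableOn_coeffIntegrand (n : ℕ) : IntegrableOn (coeffIntegrand n) quadrant := by
  refine ⟨(measurable_coeffIntegrand n).aestronglyMeasurable, ?_⟩
  rw [hasFiniteIntegral_iff_ofReal]
  · by_contra! h
    have h' := lintegral_coeffIntegrand_eq n
    rw [top_le_iff.1 h, ENNReal.mul_top] at h'
    · exact ENNReal.ofReal_ne_top h'.symm
    · simp [Nat.factorial_ne_zero]
  · filter_upwards [ae_restrict_mem measurableSet_quadrant] with p hp
    exact coeffIntegrand_nonneg n hp

theorem factorial_sq_mul_I (n : ℕ) :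
    (n.factorial : ℝ) ^ 2 * I n = 4 / 4 ^ n * ∫ z in Ioi (0 : ℝ), z ^ (2 * n + 1) * K₀ z ^ 3 := by
  have h := lintegral_coeffIntegrand_eq n
  rw [← ofReal_integral_eq_lintegral_ofReal (integrableOn_coeffIntegrand n)
    (by filter_upwards [ae_restrict_mem measurableSet_quadrant] with p hp
        exact coeffIntegrand_nonneg n hp), ← ENNReal.ofReal_mul (by positivity)] at h
  refine (ENNReal.ofReal_eq_ofReal_iff (mul_nonneg (by positivity) ?_)
    (mul_nonneg (by positivity) ?_)).1 h
  · exact setIntegral_nonneg measurableSet_quadrant fun p hp => coeffIntegrand_nonneg n hp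
  · exact setIntegral_nonneg measurableSet_Ioi fun z hz =>
      mul_nonneg (pow_nonneg (le_of_lt hz) _) (pow_nonneg (K₀_nonneg z) 3)

theorem I_eq_besselMoment (n : ℕ) :
    I n = 1 / ((4 : ℝ) ^ ((n : ℤ) - 1) * (n.factorial : ℝ) ^ 2)
        * ∫ x in Ioi (0 : ℝ), x ^ (2 * n + 1) * K₀ x ^ 3 := by
  have h := factorial_sq_mul_I n
  have h4 : (4 : ℝ) ^ ((n : ℤ) - 1) = 4 ^ n / 4 := by
    rw [zpow_sub_one₀ (by norm_num), zpow_natCast]; rfl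
  rw [h4]
  have hf : (n.factorial : ℝ) ≠ 0 := by positivity
  field_simp at h ⊢
  linarith

theorem I_recurrence {n : ℕ} (hn : 1 ≤ n) :
    (n : ℝ) ^ 2 * I (n - 1) - (3 + 10 * (n : ℝ) + 10 * (n : ℝ) ^ 2) * I n
      + 9 * ((n : ℝ) + 1) ^ 2 * I (n + 1) = 0 := by
  obtain ⟨j, rfl⟩ : ∃ j, n = j + 1 := ⟨n - 1, by omega⟩
  -- In terms of the original index this is `m = 2n`, where the boundary term vanishes.
  have h := besselMoment_relation (m := 2 * j + 2) (by omega)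
    (tendsto_besselPrimitive_add_two_zero (2 * j))
  have h0 := factorial_sq_mul_I j
  have h1 := factorial_sq_mul_I (j + 1)
  have h2 := factorial_sq_mul_I (j + 2)
  rw [show 2 * j + 2 - 1 = 2 * j + 1 by omega] at h
  rw [show 2 * (j + 1) + 1 = 2 * j + 2 + 1 by ring] at h1
  rw [show 2 * (j + 2) + 1 = 2 * j + 2 + 3 by ring] at h2
  generalize ∫ x in Ioi (0 : ℝ), x ^ (2 * j + 1) * K₀ x ^ 3 = c0 at *
  generalize ∫ x in Ioi (0 : ℝ), x ^ (2 * j + 2 + 1) * K₀ x ^ 3 = c1 at *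
  generalize ∫ x in Ioi (0 : ℝ), x ^ (2 * j + 2 + 3) * K₀ x ^ 3 = c2 at *
  rw [Nat.add_sub_cancel]
  have hf : (j.factorial : ℝ) ≠ 0 := by positivity
  have e1 : ((j + 1).factorial : ℝ) = (j + 1) * j.factorial := by
    rw [Nat.factorial_succ]; push_cast; ring
  have e2 : ((j + 2).factorial : ℝ) = (j + 2) * ((j + 1) * j.factorial) := by
    rw [Nat.factorial_succ]; push_cast; rw [e1]; ring
  rw [e1] at h1
  rw [e2] at h2
  have hc0 : c0 = 4 ^ j / 4 * (j.factorial ^ 2 * I j) := by rw [h0]; field_simp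
  have hc1 : c1 = 4 ^ j * (((j + 1) * j.factorial) ^ 2 * I (j + 1)) := by
    rw [h1, pow_succ]; field_simp
  have hc2 : c2 = 4 * 4 ^ j * (((j + 2) * ((j + 1) * j.factorial)) ^ 2 * I (j + 2)) := by
    rw [h2, pow_add]; field_simp
  rw [hc0, hc1, hc2] at h
  have hne : (4 * 4 ^ j * ((j + 1 : ℝ) * j.factorial) ^ 2) ≠ 0 := by positivity
  refine (mul_right_injective₀ hne) ?_
  push_cast at h ⊢
  linear_combination h

theorem I_one : 9 * I 1 - 3 * I 0 = -6 := by
  have h := besselMoment_relation (m := 0) (by omega) tendsto_besselPrimitive_zero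
  have h0 := factorial_sq_mul_I 0
  have h1 := factorial_sq_mul_I 1
  norm_num at h h0 h1
  rw [h0, h1]
  linarith

/-! ### The denominator off the cut and analyticity of `J` -/

theorem nine_le_mul_sum_inv {x y : ℝ} (hx : 0 < x) (hy : 0 < y) :
    9 ≤ (1 + x + y) * (1 + x⁻¹ + y⁻¹) := by
  have h : (1 + x + y) * (1 + x⁻¹ + y⁻¹) = 9 + ((x - 1) ^ 2 * y + (y - 1) ^ 2 * x + (x - y) ^ 2)
      / (x * y) := by
    field_simp
    ring
  rw [h]
  have : 0 ≤ ((x - 1) ^ 2 * y + (y - 1) ^ 2 * x + (x - y) ^ 2) / (x * y) := by positivity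
  linarith

theorem A_eq {x y : ℝ} (hx : 0 < x) (hy : 0 < y) (t : ℂ) :
    A x y t = ((x * y : ℝ) : ℂ) * ((((1 + x + y) * (1 + x⁻¹ + y⁻¹) : ℝ) : ℂ) - t) := by
  have hx' : (x : ℂ) ≠ 0 := by exact_mod_cast hx.ne'
  have hy' : (y : ℂ) ≠ 0 := by exact_mod_cast hy.ne'
  rw [A]
  push_cast
  field_simp
  ring

theorem isOpen_cutPlane : IsOpen cutPlane := by
  have h : cutPlane = ((fun r : ℝ => (r : ℂ)) '' Ici 9)ᶜ := by
    ext t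
    simp only [cutPlane, mem_ofPred_eq, mem_compl_iff, mem_image, not_exists, not_and, mem_Ici]
    exact forall₂_congr fun r _ => ne_comm
  rw [h]
  exact (Complex.isometry_ofReal.isClosedEmbedding.isClosedMap _ isClosed_Ici).isOpen_compl

theorem zero_mem_cutPlane : (0 : ℂ) ∈ cutPlane := fun r hr h => by
  have : (0 : ℝ) = r := by exact_mod_cast h
  linarith

theorem ball_subset_cutPlane : Metric.ball (0 : ℂ) 9 ⊆ cutPlane := by
  rintro t ht r hr rfl
  rw [mem_ball_zero_iff, Complex.norm_real, Real.norm_of_nonneg (by linarith)] at ht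
  linarith

theorem isPreconnected_cutPlane : IsPreconnected cutPlane := by
  suffices h : StarConvex ℝ (0 : ℂ) cutPlane from
    (h.isPathConnected zero_mem_cutPlane).isConnected.2
  intro t ht a b _ hb hab r hr h
  rw [smul_zero, zero_add, Complex.real_smul] at h
  have hb0 : b ≠ 0 := by
    rintro rfl
    have : (0 : ℝ) = r := by simpa using congrArg Complex.re h
    linarith
  have hb' : 0 < b := lt_of_le_of_ne hb hb0.symm
  refine ht (r / b) (by rw [le_div_iff₀ hb']; nlinarith) ?_
  have : (b : ℂ) ≠ 0 := by exact_mod_cast hb0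
  push_cast
  rw [← h]
  field_simp

/-- Near `t` the distance to the cut is at least `ε/2`, so the bounded quantity `‖s‖` is at most a
multiple of `‖r - s‖`; then `r ≤ ‖r - s‖ + ‖s‖`. Applied with `r = D`, this dominates both the
integrand and its `t`-derivative. -/
theorem exists_ball_le_mul_norm_sub {t : ℂ} (ht : t ∈ cutPlane) :
    ∃ ε > 0, ∃ C > 0, Metric.ball t ε ⊆ cutPlane ∧
      ∀ s ∈ Metric.ball t ε, ∀ r : ℝ, 9 ≤ r → r ≤ C * ‖(r : ℂ) - s‖ := by
  obtain ⟨ε, hε, hsub⟩ := Metric.isOpen_iff.1 isOpen_cutPlane t ht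
  refine ⟨ε / 2, half_pos hε, 1 + (‖t‖ + ε / 2) / (ε / 2), by positivity,
    (Metric.ball_subset_ball (by linarith)).trans hsub, fun s hs r hr => ?_⟩
  have hrt : ε ≤ ‖(r : ℂ) - t‖ := by
    by_contra! h
    exact hsub (mem_ball_iff_norm.2 h) r hr rfl
  rw [mem_ball_iff_norm] at hs
  have h1 : ‖(r : ℂ) - t‖ ≤ ‖(r : ℂ) - s‖ + ‖s - t‖ := norm_sub_le_norm_sub_add_norm_sub _ _ _
  have h2 : r ≤ ‖(r : ℂ) - s‖ + ‖s‖ := by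
    have := norm_add_le ((r : ℂ) - s) s
    rwa [sub_add_cancel, Complex.norm_real, Real.norm_of_nonneg (by linarith)] at this
  have h3 : ‖s‖ ≤ ‖s - t‖ + ‖t‖ := by simpa using norm_add_le (s - t) t
  have h4 : ε / 2 ≤ ‖(r : ℂ) - s‖ := by linarith
  have h5 : (‖t‖ + ε / 2) ≤ (‖t‖ + ε / 2) / (ε / 2) * ‖(r : ℂ) - s‖ := by
    rw [div_mul_eq_mul_div, le_div_iff₀ (half_pos hε)]
    gcongr
  linarith

theorem A_ne_zero {t : ℂ} (ht : t ∈ cutPlane) {p : ℝ × ℝ} (hp : p ∈ quadrant) :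
    A p.1 p.2 t ≠ 0 := by
  obtain ⟨hx, hy⟩ := hp
  have hx : 0 < p.1 := hx
  have hy : 0 < p.2 := hy
  rw [A_eq hx hy]
  refine mul_ne_zero (by exact_mod_cast (mul_pos hx hy).ne') (sub_ne_zero.2 fun h => ?_)
  exact ht _ (nine_le_mul_sum_inv hx hy) h.symm

theorem norm_one_div_A_le {s : ℂ} {C : ℝ} (hC : 0 < C)
    (h : ∀ r : ℝ, 9 ≤ r → r ≤ C * ‖(r : ℂ) - s‖) {p : ℝ × ℝ} (hp : p ∈ quadrant) :
    ‖1 / A p.1 p.2 s‖ ≤ C * coeffIntegrand 0 p ∧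
      ‖((p.1 * p.2 : ℝ) : ℂ) / A p.1 p.2 s ^ 2‖ ≤ C ^ 2 * coeffIntegrand 1 p := by
  obtain ⟨hx, hy⟩ := hp
  have hx : 0 < p.1 := hx
  have hy : 0 < p.2 := hy
  have h9 := nine_le_mul_sum_inv hx hy
  have hD := h _ h9
  rw [A_eq hx hy]
  simp only [coeffIntegrand]
  set D := (1 + p.1 + p.2) * (1 + p.1⁻¹ + p.2⁻¹)
  set w := p.1 * p.2
  have hw : 0 < w := mul_pos hx hy
  have hD0 : 0 < D := by linarith
  set N := ‖(D : ℂ) - s‖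
  have hN : 0 < N := by
    by_contra! hN
    nlinarith
  have key : N⁻¹ ≤ C * D⁻¹ := by
    rw [inv_le_comm₀ hN (by positivity), mul_inv, inv_inv, inv_mul_le_iff₀ hC]
    exact hD
  constructor
  · rw [norm_div, norm_mul, norm_one, Complex.norm_real, Real.norm_of_nonneg hw.le]
    calc 1 / (w * N) = N⁻¹ / w := by field_simp
      _ ≤ (C * D⁻¹) / w := by gcongr
      _ = _ := by rw [zero_add, pow_one]; ring
  · rw [norm_div, norm_pow, norm_mul, Complex.norm_real, Real.norm_of_nonneg hw.le]
    calc w / (w * N) ^ 2 = N⁻¹ ^ 2 / w := by field_simp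
      _ ≤ (C * D⁻¹) ^ 2 / w := by gcongr
      _ = _ := by rw [one_add_one_eq_two, mul_pow, inv_pow, mul_div_assoc]

theorem measurable_one_div_A (t : ℂ) : Measurable fun p : ℝ × ℝ => 1 / A p.1 p.2 t := by
  unfold A; fun_prop

theorem integrableOn_one_div_A {t : ℂ} (ht : t ∈ cutPlane) :
    IntegrableOn (fun p : ℝ × ℝ => 1 / A p.1 p.2 t) quadrant := by
  obtain ⟨ε, hε, C, hC, -, hb⟩ := exists_ball_le_mul_norm_sub ht
  refine Integrable.mono' ((integrableOn_coeffIntegrand 0).const_mul C)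
    (measurable_one_div_A t).aestronglyMeasurable ?_
  filter_upwards [ae_restrict_mem measurableSet_quadrant] with p hp
  exact (norm_one_div_A_le hC (hb t (Metric.mem_ball_self hε)) hp).1

theorem differentiableAt_J {t : ℂ} (ht : t ∈ cutPlane) : DifferentiableAt ℂ J t := by
  obtain ⟨ε, hε, C, hC, hsub, hb⟩ := exists_ball_le_mul_norm_sub ht
  refine (hasDerivAt_integral_of_dominated_loc_of_deriv_le (μ := volume.restrict quadrant)
    (F := fun t (p : ℝ × ℝ) => 1 / A p.1 p.2 t)
    (F' := fun t (p : ℝ × ℝ) => ((p.1 * p.2 : ℝ) : ℂ) / A p.1 p.2 t ^ 2)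
    (bound := fun p => C ^ 2 * coeffIntegrand 1 p)
    (Metric.ball_mem_nhds t hε)
    (Eventually.of_forall fun s => (measurable_one_div_A s).aestronglyMeasurable)
    (integrableOn_one_div_A ht) ?_ ?_ ((integrableOn_coeffIntegrand 1).const_mul _)
    ?_).2.differentiableAt
  · refine Measurable.aestronglyMeasurable ?_
    unfold A; fun_prop
  · filter_upwards [ae_restrict_mem measurableSet_quadrant] with p hp s hs
    exact (norm_one_div_A_le hC (hb s hs) hp).2
  · filter_upwards [ae_restrict_mem measurableSet_quadrant] with p hp s hs
    have hA : HasDerivAt (fun s => A p.1 p.2 s) (-((p.1 : ℂ) * p.2)) s := by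
      simpa [A] using ((hasDerivAt_id s).const_mul ((p.1 : ℂ) * p.2)).const_sub
        ((1 + (p.1 : ℂ) + p.2) * (p.1 + p.2 + p.1 * p.2))
    simp only [one_div]
    refine (hA.fun_inv (A_ne_zero (hsub hs) hp)).congr_deriv ?_
    rw [neg_neg]
    push_cast
    rfl

theorem analyticOnNhd_J : AnalyticOnNhd ℂ J cutPlane :=
  DifferentiableOn.analyticOnNhd (fun _ ht => (differentiableAt_J ht).differentiableWithinAt)
    isOpen_cutPlane

/-! ### Power series of `J` at 0 -/

theorem I_nonneg (n : ℕ) : 0 ≤ I n :=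
  setIntegral_nonneg measurableSet_quadrant fun _ hp => coeffIntegrand_nonneg n hp

theorem I_le (n : ℕ) : I n ≤ I 0 * (1 / 9) ^ n := by
  rw [mul_comm, I, I, ← integral_const_mul]
  refine setIntegral_mono_on (integrableOn_coeffIntegrand n)
    ((integrableOn_coeffIntegrand 0).const_mul _) measurableSet_quadrant fun p hp => ?_
  obtain ⟨hx, hy⟩ := hp
  have hx : 0 < p.1 := hx
  have hy : 0 < p.2 := hy
  have h9 := nine_le_mul_sum_inv hx hy
  simp only [coeffIntegrand]
  set D := (1 + p.1 + p.2) * (1 + p.1⁻¹ + p.2⁻¹)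
  have hD0 : 0 < D := by linarith
  rw [← mul_div_assoc, zero_add, pow_one, pow_succ, mul_inv, one_div, inv_pow]
  gcongr

/-- Expand `1 / (D - t)` geometrically in `t / D`; since `I_n ≤ I_0 9^(-n)`, the series of
integrated norms converges and sum and integral may be exchanged. -/
theorem hasSum_J {t : ℂ} (ht : ‖t‖ < 9) : HasSum (fun n : ℕ => (I n : ℂ) * t ^ n) (J t) := by
  have hint : ∀ n, Integrable (fun p => (coeffIntegrand n p : ℂ) * t ^ n)
      (volume.restrict quadrant) := fun n => (integrableOn_coeffIntegrand n).ofReal.mul_const _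
  have hnorm : ∀ n, ∫ p in quadrant, ‖(coeffIntegrand n p : ℂ) * t ^ n‖ = I n * ‖t‖ ^ n := by
    intro n
    rw [I, ← integral_mul_const]
    refine setIntegral_congr_fun measurableSet_quadrant fun p hp => ?_
    rw [norm_mul, norm_pow, Complex.norm_real, Real.norm_of_nonneg (coeffIntegrand_nonneg n hp)]
  have hsum : Summable fun n => ∫ p in quadrant, ‖(coeffIntegrand n p : ℂ) * t ^ n‖ := by
    simp_rw [hnorm]
    refine Summable.of_nonneg_of_le (fun n => mul_nonneg (I_nonneg n) (by positivity))
      (f := fun n => I 0 * (‖t‖ / 9) ^ n) (fun n => ?_)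
      ((summable_geometric_of_lt_one (by positivity) (by linarith)).mul_left _)
    calc I n * ‖t‖ ^ n ≤ I 0 * (1 / 9) ^ n * ‖t‖ ^ n := by gcongr; exact I_le n
      _ = _ := by rw [mul_assoc, ← mul_pow, one_div_mul_eq_div]
  have h := hasSum_integral_of_summable_integral_norm hint hsum
  have hl : ∀ n, ∫ p in quadrant, (coeffIntegrand n p : ℂ) * t ^ n = (I n : ℂ) * t ^ n := by
    intro n
    rw [integral_mul_const, I, ← integral_complex_ofReal]
  have hr : ∫ p in quadrant, (∑' n, (coeffIntegrand n p : ℂ) * t ^ n) = J t := by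
    rw [J]
    refine setIntegral_congr_fun measurableSet_quadrant fun p hp => ?_
    have hA := A_ne_zero (ball_subset_cutPlane (mem_ball_zero_iff.2 ht)) hp
    obtain ⟨hx, hy⟩ := hp
    have hx : 0 < p.1 := hx
    have hy : 0 < p.2 := hy
    have h9 := nine_le_mul_sum_inv hx hy
    simp only [coeffIntegrand]
    rw [A_eq hx hy] at hA ⊢
    set D := (1 + p.1 + p.2) * (1 + p.1⁻¹ + p.2⁻¹)
    have hD0 : (D : ℂ) ≠ 0 := by
      have : D ≠ 0 := by linarith
      exact_mod_cast this
    obtain ⟨hw, hDt⟩ := mul_ne_zero_iff.1 hA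
    have hg : ‖t / D‖ < 1 := by
      rw [norm_div, Complex.norm_real, Real.norm_of_nonneg (by linarith), div_lt_one (by linarith)]
      linarith
    have hs := (hasSum_geometric_of_norm_lt_one hg).mul_left ((D : ℂ)⁻¹ / ((p.1 * p.2 : ℝ) : ℂ))
    refine (HasSum.tsum_eq (hs.congr_fun fun n => ?_)).trans ?_
    · push_cast
      rw [div_pow, pow_succ, mul_inv]
      field_simp
    · have : 1 - t / D = (D - t) / D := by field_simp
      rw [this]
      field_simp
  simp_rw [hl] at h
  rwa [hr] at h

/-! ### The Picard–Fuchs equation -/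

theorem norm_I_mul_le (n : ℕ) (c : ℂ) {b : ℝ} (hc : ‖c‖ ≤ b) :
    ‖(I n : ℂ) * c‖ ≤ b * (I 0 * (1 / 9) ^ n) := by
  rw [norm_mul, Complex.norm_real, Real.norm_of_nonneg (I_nonneg n), mul_comm]
  exact mul_le_mul hc (I_le n) (I_nonneg n) ((norm_nonneg c).trans hc)

/-- The unit disc suffices for the identity theorem, and there powers of `z` are bounded by 1, so
`9^(-n)` alone gives uniform convergence. -/
theorem hasSum_deriv_J {z : ℂ} (hz : z ∈ Metric.ball (0 : ℂ) 1) :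
    HasSum (fun n : ℕ => (I n : ℂ) * (n * z ^ (n - 1))) (deriv J z) := by
  have h := Complex.hasSum_deriv_of_summable_norm (F := fun (n : ℕ) (z : ℂ) => (I n : ℂ) * z ^ n)
    (u := fun n => 1 * (I 0 * (1 / 9) ^ n)) (U := Metric.ball 0 1)
    (((summable_geometric_of_lt_one (by norm_num) (by norm_num)).mul_left _).mul_left _)
    (fun n => by fun_prop) Metric.isOpen_ball (fun n w hw => norm_I_mul_le n _ (by
      rw [norm_pow]
      exact pow_le_one₀ (norm_nonneg _) (mem_ball_zero_iff.1 hw).le)) hz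
  have he : (fun w : ℂ => ∑' n : ℕ, (I n : ℂ) * w ^ n) =ᶠ[𝓝 z] J := by
    filter_upwards [Metric.isOpen_ball.mem_nhds hz] with w hw
    exact (hasSum_J ((mem_ball_zero_iff.1 hw).trans (by norm_num))).tsum_eq
  rw [he.deriv_eq] at h
  refine h.congr_fun fun n => ?_
  simp

/-- The differential operator of the Picard–Fuchs equation, applied to `J`. -/
noncomputable def picardFuchs (t : ℂ) : ℂ :=
  deriv (fun s : ℂ => s * (s - 1) * (s - 9) * deriv J s) t + (t - 3) * J t

theorem hasSum_picardFuchs {z : ℂ} (hz : z ∈ Metric.ball (0 : ℂ) 1) :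
    HasSum (fun n : ℕ => (I n : ℂ) * ((n + 1) ^ 2 * z ^ (n + 1)
      - (10 * n ^ 2 + 10 * n + 3) * z ^ n + 9 * n ^ 2 * z ^ (n - 1))) (picardFuchs z) := by
  -- From `s(s-1)(s-9) = s³ - 10s² + 9s`; the bound is `20 = 1 + 10 + 9`.
  have hterm : ∀ (n : ℕ) (w : ℂ), w ∈ Metric.ball (0 : ℂ) 1 →
      ‖(n : ℂ) * (w ^ (n + 2) - 10 * w ^ (n + 1) + 9 * w ^ n)‖ ≤ 20 * n := by
    intro n w hw
    have hw1 : ‖w‖ ≤ 1 := (mem_ball_zero_iff.1 hw).le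
    have hp : ∀ k, ‖w ^ k‖ ≤ 1 := fun k => by
      rw [norm_pow]; exact pow_le_one₀ (norm_nonneg _) hw1
    have h1 : ‖w ^ (n + 2) - 10 * w ^ (n + 1) + 9 * w ^ n‖ ≤ 20 := by
      refine (norm_add_le _ _).trans ?_
      have h2 := norm_sub_le (w ^ (n + 2)) (10 * w ^ (n + 1))
      rw [norm_mul] at h2 ⊢
      have h10 : ‖(10 : ℂ)‖ = 10 := by simp
      have h9 : ‖(9 : ℂ)‖ = 9 := by simp
      rw [h10] at h2
      rw [h9]
      linarith [hp (n + 2), hp (n + 1), hp n]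
    rw [norm_mul, Complex.norm_natCast, mul_comm]
    gcongr
  have hu : Summable fun n : ℕ => (20 * n : ℝ) * (I 0 * (1 / 9) ^ n) := by
    have := summable_pow_mul_geometric_of_norm_lt_one 1 (r := (1 / 9 : ℝ)) (by norm_num)
    refine (this.mul_left (20 * I 0)).congr fun n => ?_
    ring
  have h := Complex.hasSum_deriv_of_summable_norm
    (F := fun (n : ℕ) (w : ℂ) => (I n : ℂ) * (n * (w ^ (n + 2) - 10 * w ^ (n + 1) + 9 * w ^ n)))
    (U := Metric.ball 0 1) hu
    (fun n => by fun_prop) Metric.isOpen_ball (fun n w hw => norm_I_mul_le n _ (hterm n w hw)) hz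
  have he : (fun w : ℂ => ∑' n : ℕ, (I n : ℂ) * (n * (w ^ (n + 2) - 10 * w ^ (n + 1) + 9 * w ^ n)))
      =ᶠ[𝓝 z] fun s => s * (s - 1) * (s - 9) * deriv J s := by
    filter_upwards [Metric.isOpen_ball.mem_nhds hz] with w hw
    refine (((hasSum_deriv_J hw).mul_left (w * (w - 1) * (w - 9))).congr_fun fun n => ?_).tsum_eq
    -- At `n = 0` the exponent `n - 1` is truncated, but the factor `n` kills the term.
    rcases n with _ | n
    · simp
    · rw [Nat.add_sub_cancel]
      ring
  rw [he.deriv_eq] at h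
  have hJ := (hasSum_J ((mem_ball_zero_iff.1 hz).trans (by norm_num))).mul_left (z - 3)
  refine (h.add hJ).congr_fun fun n => ?_
  have hd : HasDerivAt (fun w : ℂ => (I n : ℂ) * (n * (w ^ (n + 2) - 10 * w ^ (n + 1) + 9 * w ^ n)))
      ((I n : ℂ) * (n * ((n + 2 : ℕ) * z ^ (n + 1) - 10 * ((n + 1 : ℕ) * z ^ n)
        + 9 * (n * z ^ (n - 1))))) z :=
    (((((hasDerivAt_pow (n + 2) z).fun_sub ((hasDerivAt_pow (n + 1) z).const_mul 10)).fun_add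
      ((hasDerivAt_pow n z).const_mul 9)).const_mul _).const_mul _)
  rw [hd.deriv]
  push_cast
  ring

theorem picardFuchs_eq_of_mem_ball {z : ℂ} (hz : z ∈ Metric.ball (0 : ℂ) 1) :
    picardFuchs z = -6 := by
  have hz1 : ‖z‖ ≤ 1 := (mem_ball_zero_iff.1 hz).le
  -- Grouped by powers of `z`, the coefficients of `z, …, z^(N-1)` vanish by the recursion and the
  -- constant is `9 I_1 - 3 I_0`. What remains are the incomplete groups at `z^N` and `z^(N+1)`,
  -- which tend to 0 because `N² 9^(-N)` does.
  have hpart : ∀ N : ℕ, ∑ n ∈ Finset.range (N + 1), (I n : ℂ) * ((n + 1) ^ 2 * z ^ (n + 1)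
      - (10 * n ^ 2 + 10 * n + 3) * z ^ n + 9 * n ^ 2 * z ^ (n - 1))
      = (I N : ℂ) * ((N + 1) ^ 2 * z ^ (N + 1)) - (I (N + 1) : ℂ) * (9 * (N + 1) ^ 2 * z ^ N)
        + -6 := by
    intro N
    induction N with
    | zero =>
      have h : (9 * I 1 - 3 * I 0 : ℂ) = -6 := by exact_mod_cast I_one
      simp
      linear_combination h
    | succ N ih =>
      have h : ((N + 1 : ℂ)) ^ 2 * I N - (3 + 10 * (N + 1 : ℂ) + 10 * (N + 1 : ℂ) ^ 2) * I (N + 1)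
          + 9 * ((N + 1 : ℂ) + 1) ^ 2 * I (N + 2) = 0 := by
        have := I_recurrence (n := N + 1) (by omega)
        rw [Nat.add_sub_cancel] at this
        exact_mod_cast this
      rw [Finset.sum_range_succ, ih, Nat.add_sub_cancel]
      push_cast
      linear_combination z ^ (N + 1) * h
  have hlim : Tendsto (fun N : ℕ => ((N : ℝ) + 1) ^ 2 * (1 / 9 : ℝ) ^ N) atTop (𝓝 0) := by
    have h := ((tendsto_pow_const_mul_const_pow_of_abs_lt_one 2 (r := (1 / 9 : ℝ))
      (by rw [abs_of_pos] <;> norm_num)).comp (tendsto_add_atTop_nat 1)).const_mul 9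
    rw [mul_zero] at h
    refine h.congr fun N => ?_
    simp only [Function.comp_apply, pow_succ]
    push_cast
    ring
  have hsq : ∀ (N k : ℕ), ‖((N : ℂ) + 1) ^ 2 * z ^ k‖ ≤ ((N : ℝ) + 1) ^ 2 := by
    intro N k
    have : ‖(N : ℂ) + 1‖ = N + 1 := by
      have := Complex.norm_natCast (N + 1)
      push_cast at this
      exact this
    rw [norm_mul, norm_pow, norm_pow, this]
    exact mul_le_of_le_one_right (by positivity) (pow_le_one₀ (norm_nonneg _) hz1)
  have h1 : Tendsto (fun N : ℕ => (I N : ℂ) * (((N : ℂ) + 1) ^ 2 * z ^ (N + 1))) atTop (𝓝 0) := by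
    refine squeeze_zero_norm (fun N => norm_I_mul_le N _ (hsq N (N + 1))) ?_
    have := hlim.const_mul (I 0)
    rw [mul_zero] at this
    exact this.congr fun N => by ring
  have h2 : Tendsto (fun N : ℕ => (I (N + 1) : ℂ) * (9 * ((N : ℂ) + 1) ^ 2 * z ^ N))
      atTop (𝓝 0) := by
    refine squeeze_zero_norm (fun N => norm_I_mul_le (N + 1) _ (b := 9 * ((N : ℝ) + 1) ^ 2) ?_) ?_
    · rw [mul_assoc, norm_mul]
      have h9 : ‖(9 : ℂ)‖ = 9 := by simp
      rw [h9]
      exact mul_le_mul_of_nonneg_left (hsq N N) (by norm_num)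
    · have := hlim.const_mul (I 0)
      rw [mul_zero] at this
      exact this.congr fun N => by ring
  have h3 := ((hasSum_picardFuchs hz).tendsto_sum_nat).comp (tendsto_add_atTop_nat 1)
  have h4 := (h1.sub h2).add_const (-6)
  rw [sub_zero, zero_add] at h4
  exact tendsto_nhds_unique h3 (h4.congr fun N => (hpart N).symm)

/-- Both sides are analytic on the connected cut plane and agree near 0. -/
theorem picardFuchs_eq {t : ℂ} (ht : t ∈ cutPlane) : picardFuchs t = -6 := by
  have han : AnalyticOnNhd ℂ picardFuchs cutPlane := by
    have hpoly : AnalyticOnNhd ℂ (fun s : ℂ => s * (s - 1) * (s - 9)) cutPlane := fun _ _ => by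
      fun_prop
    have hlin : AnalyticOnNhd ℂ (fun s : ℂ => s - 3) cutPlane := fun _ _ => by fun_prop
    exact ((hpoly.mul analyticOnNhd_J.deriv).deriv).add (hlin.mul analyticOnNhd_J)
  refine han.eqOn_of_preconnected_of_eventuallyEq analyticOnNhd_const isPreconnected_cutPlane
    zero_mem_cutPlane ?_ ht
  filter_upwards [Metric.ball_mem_nhds (0 : ℂ) one_pos] with z hz
  exact picardFuchs_eq_of_mem_ball hz

theorem I_one_eq_J_zero : (I 1 : ℂ) = (J 0 - 2) / 3 := by
  have h := hasSum_J (t := 0) (by norm_num)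
  have h0 : J 0 = I 0 := by
    refine h.unique ((hasSum_single 0 fun n hn => ?_).congr_fun fun n => rfl) |>.trans (by simp)
    simp [hn]
  have h1 : (9 * I 1 - 3 * I 0 : ℂ) = -6 := by exact_mod_cast I_one
  rw [h0]
  linear_combination h1 / 9

end Sunset
end

theorem mainTheorem2 :
    -- the integral defining `J` converges absolutely and is analytic off the cut
    (∀ t ∈ Sunset.cutPlane,
      (∀ p ∈ Sunset.quadrant, Sunset.A (p.1 : ℂ) (p.2 : ℂ) t ≠ 0) ∧
      MeasureTheory.IntegrableOn
        (fun p : ℝ × ℝ => 1 / Sunset.A (p.1 : ℂ) (p.2 : ℂ) t) Sunset.quadrant) ∧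
    AnalyticOnNhd ℂ Sunset.J Sunset.cutPlane ∧
    -- the inhomogeneous Picard–Fuchs equation
    (∀ t ∈ Sunset.cutPlane,
      deriv (fun s : ℂ => s * (s - 1) * (s - 9) * deriv Sunset.J s) t
        + (t - 3) * Sunset.J t = -6) ∧
    -- the expansion in powers of `t`
    (∀ n : ℕ, MeasureTheory.IntegrableOn (Sunset.coeffIntegrand n) Sunset.quadrant) ∧
    (∀ t : ℂ, ‖t‖ < 9 → HasSum (fun n : ℕ => (Sunset.I n : ℂ) * t ^ n) (Sunset.J t)) ∧
    -- the coefficients are Bessel moments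
    (∀ n : ℕ,
      MeasureTheory.IntegrableOn
        (fun x : ℝ => x ^ (2 * n + 1) * Sunset.K₀ x ^ 3) (Set.Ioi 0) ∧
      Sunset.I n = 1 / ((4 : ℝ) ^ ((n : ℤ) - 1) * (n.factorial : ℝ) ^ 2)
        * ∫ x in Set.Ioi (0 : ℝ), x ^ (2 * n + 1) * Sunset.K₀ x ^ 3) ∧
    -- the Apéry-like recursion
    (∀ n : ℕ, 1 ≤ n →
      (n : ℝ) ^ 2 * Sunset.I (n - 1) - (3 + 10 * (n : ℝ) + 10 * (n : ℝ) ^ 2) * Sunset.I n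
        + 9 * ((n : ℝ) + 1) ^ 2 * Sunset.I (n + 1) = 0) ∧
    -- the initial relation
    (Sunset.I 1 : ℂ) = (Sunset.J 0 - 2) / 3 := by
  refine ⟨fun t ht => ⟨fun p hp => Sunset.A_ne_zero ht hp, Sunset.integrableOn_one_div_A ht⟩,
    Sunset.analyticOnNhd_J, fun t ht => Sunset.picardFuchs_eq ht,
    Sunset.integrableOn_coeffIntegrand, fun t ht => Sunset.hasSum_J ht,
    fun n => ⟨Sunset.integrableOn_pow_mul_K₀_cube (by omega), Sunset.I_eq_besselMoment n⟩,
    fun n hn => Sunset.I_recurrence hn, Sunset.I_one_eq_J_zero⟩
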